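/- Let $a,b,c\in\mathbb{R}$ and $\sigma_\epsilon^2>0$. On a probability space, let $\epsilon=(\epsilon_{i,j})_{i,j\in\mathbb{Z}}$ be uncorrelated real random variables with zero mean and common variance $\sigma_\epsilon^2$, and let $X=(X_{i,j})_{i,j\in\mathbb{Z}}$ be a real wide-sense stationary random field (finite second moments, constant mean, covariances invariant under shifts of the lattice) such that, almost surely for each $i,j\in\mathbb{Z}$, \[ X_{i,j}=a\,X_{i-1,j}+b\,X_{i,j-1}+c\,X_{i-1,j-1}+\epsilon_{i,j}. \] Let $\gamma_X(h_1,h_2)=\operatorname{cov}(X_{i,j},X_{i-h_1,j-h_2})$ be the autocovariance function of $X$. Then $\gamma_X(0,0)>0$ and the following hold. 1. If $ab+c=0$, then \[ \gamma_X(h_1,h_2)=\frac{\gamma_X(h_1,0)\,\gamma_X(0,h_2)}{\gamma_X(0,0)}\qquad\text{for all } h_1,h_2\in\mathbb{Z}. \] 2. If $ab+c\neq0$ and $1+c^2>a^2+b^2$, then \[ \gamma_X(1,-1)=\frac{\gamma_X(1,0)\,\gamma_X(0,1)}{\gamma_X(0,0)}\neq\gamma_X(1,1), \] \[ \gamma_X(h_1,h_2)=\frac{\gamma_X(h_1,0)\,\gamma_X(0,h_2)}{\gamma_X(0,0)}\qquad\text{for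 all } h_1,h_2\in\mathbb{Z}\text{ with } h_1h_2\le0. \] 3. If $ab+c\neq0$ and $1+c^2<a^2+b^2$, then \[ \gamma_X(1,-1)\neq\frac{\gamma_X(1,0)\,\gamma_X(0,1)}{\gamma_X(0,0)}=\gamma_X(1,1), \] \[ \gamma_X(h_1,h_2)=\frac{\gamma_X(h_1,0)\,\gamma_X(0,h_2)}{\gamma_X(0,0)}\qquad\text{for all } h_1,h_2\in\mathbb{Z}\text{ with } h_1h_2\ge0. \] -/

import Mathlib

open MeasureTheory ProbabilityTheory

namespace PlanarAR

/-- A real random field on the planar integer lattice is wide-sense stationary: finite second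
moments, constant mean, and covariances invariant under simultaneous shifts of both sites. -/
structure IsWideSenseStationary {Ω : Type*} [MeasurableSpace Ω] (μ : Measure Ω)
    (X : ℤ → ℤ → Ω → ℝ) : Prop where
  memLp_two : ∀ i j, MemLp (X i j) 2 μ
  mean_eq : ∀ i j i' j', ∫ ω, X i j ω ∂μ = ∫ ω, X i' j' ω ∂μ
  cov_shift : ∀ i j i' j' k l,
    cov[X (i + k) (j + l), X (i' + k) (j' + l); μ] = cov[X i j, X i' j'; μ]

/-- Uncorrelated zero-mean random variables indexed by the planar integer lattice,
all with variance `v`. -/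
structure IsWhiteNoise {Ω : Type*} [MeasurableSpace Ω] (μ : Measure Ω)
    (ε : ℤ → ℤ → Ω → ℝ) (v : ℝ) : Prop where
  memLp_two : ∀ i j, MemLp (ε i j) 2 μ
  mean_zero : ∀ i j, ∫ ω, ε i j ω ∂μ = 0
  variance_eq : ∀ i j, Var[ε i j; μ] = v
  uncorrelated : ∀ i j i' j', (i, j) ≠ (i', j') → cov[ε i j, ε i' j'; μ] = 0

/-- The first-order planar autoregressive equation; the equality of random variables at each
site is understood almost surely. -/
def SatisfiesAR {Ω : Type*} [MeasurableSpace Ω] (μ : Measure Ω)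
    (a b c : ℝ) (X ε : ℤ → ℤ → Ω → ℝ) : Prop :=
  ∀ i j, ∀ᵐ ω ∂μ,
    X i j ω = a * X (i - 1) j ω + b * X i (j - 1) ω + c * X (i - 1) (j - 1) ω + ε i j ω

/-- The autocovariance function `γ_X(h₁, h₂) = cov(X_{i,j}, X_{i-h₁,j-h₂})`, evaluated at the site
`i = j = 0`; for a wide-sense stationary field the choice of the site is immaterial. -/
noncomputable def acov {Ω : Type*} [MeasurableSpace Ω] (μ : Measure Ω)
    (X : ℤ → ℤ → Ω → ℝ) (h₁ h₂ : ℤ) : ℝ :=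
  cov[X 0 0, X (-h₁) (-h₂); μ]

theorem IsWideSenseStationary.cov_eq_acov {Ω : Type*} [MeasurableSpace Ω] {μ : Measure Ω}
    {X : ℤ → ℤ → Ω → ℝ} (hX : IsWideSenseStationary μ X) (i j h₁ h₂ : ℤ) :
    cov[X i j, X (i - h₁) (j - h₂); μ] = acov μ X h₁ h₂ := by
  have h := hX.cov_shift 0 0 (-h₁) (-h₂) i j
  have e₁ : -h₁ + i = i - h₁ := by ring
  have e₂ : -h₂ + j = j - h₂ := by ring
  rw [zero_add, zero_add, e₁, e₂] at h
  exact h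

end PlanarAR

namespace PlanarAR

/-! Let g(h,k) = cov(X_{h,k}, ε_{0,0}). The equation gives `arOpAdj` γ = g and `arOp` g = v·δ₀, and
Bessel's inequality puts g in ℓ². These facts, with γ even and bounded by γ(0,0), form
`IsARCovariance` and are all that is used.

The symbol P(z,w) = 1 - az - bw - czw has no zero on the torus, since a zero would contradict the
point source v ≠ 0 (`discrim_pos`). Hence D = (1+b²-a²-c²)² - 4(b+ac)², the product of the four
values P(±1,±1), is positive. As also D = (1+c²-a²-b²)² - 4(c+ab)², equality 1+c² = a²+b² never
occurs.

If all P(±1,±1) are positive, an energy estimate makes g vanish where h < 0 or k < 0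
(`arOpAdj_eq_zero`). The resulting Yule-Walker equations combine into a three-term recurrence along
each ray, whose bounded solutions are geometric (`exists_geometric`). So γ(m,-n) = γ(0,0) sᵐ rⁿ for
m, n ≥ 0.

The other sign patterns reduce to this one by reflecting lattice axes, which permutes the
coefficients of P up to scaling and multiplies ab+c by a nonzero factor. -/

/-! ### Averaging square-summable fields over large boxes -/

lemma sum_Icc_le_of_summable_sq {g : ℤ × ℤ → ℝ} (hs : Summable fun p => g p ^ 2) {η : ℝ}
    (hη : 0 < η) : ∃ N : ℕ, 0 < N ∧
      ∑ p ∈ Finset.Icc ((-N : ℤ), (-N : ℤ)) ((N : ℤ), (N : ℤ)), |g p| ≤ η * N := by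
  obtain ⟨F, hF⟩ := summable_iff_vanishing_norm.mp hs ((η / 6) ^ 2) (by positivity)
  -- Off F, Cauchy-Schwarz on at most (3N)² points gives 3N · η/6 = ηN/2. The fixed sum over F is
  -- absorbed into the other ηN/2 by the choice of N.
  obtain ⟨N, hN⟩ := exists_nat_ge (2 * (∑ p ∈ F, |g p|) / η + 1)
  have hA : 0 ≤ ∑ p ∈ F, |g p| := Finset.sum_nonneg fun _ _ => abs_nonneg _
  have hN1 : (1 : ℝ) ≤ N := by
    have : 0 ≤ 2 * (∑ p ∈ F, |g p|) / η := by positivity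
    linarith
  refine ⟨N, by exact_mod_cast hN1, ?_⟩
  set B := Finset.Icc ((-N : ℤ), (-N : ℤ)) ((N : ℤ), (N : ℤ)) with hB
  have hcard : (B.card : ℝ) = (2 * N + 1) ^ 2 := by
    have : B.card = (2 * N + 1) ^ 2 := by
      rw [hB, ← Finset.Icc_product_Icc, Finset.card_product, Int.card_Icc, pow_two]
      congr 1 <;> omega
    rw [this]; push_cast; ring
  have h1 : ∑ p ∈ B, |g p| ≤ ∑ p ∈ F, |g p| + ∑ p ∈ B \ F, |g p| := by
    rw [← Finset.sum_inter_add_sum_sdiff B F]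
    gcongr
    exact Finset.inter_subset_right
  have h2 : (∑ p ∈ B \ F, |g p|) ^ 2 ≤ (η / 2 * N) ^ 2 := by
    have hlt := hF (B \ F) Finset.sdiff_disjoint
    have hle := sq_sum_le_card_mul_sum_sq (s := B \ F) (f := fun p => |g p|)
    simp only [sq_abs] at hle
    have hc : ((B \ F).card : ℝ) ≤ (3 * N) ^ 2 := by
      have : ((B \ F).card : ℝ) ≤ B.card := by
        exact_mod_cast Finset.card_le_card Finset.sdiff_subset
      rw [hcard] at this
      refine this.trans ?_
      gcongr
      linarith
    calc _ ≤ _ := hle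
      _ ≤ (3 * N) ^ 2 * (η / 6) ^ 2 := by
        gcongr
        exact (le_abs_self _).trans hlt.le
      _ = _ := by ring
  have h3 := abs_le_of_sq_le_sq h2 (by positivity)
  have h4 : ∑ p ∈ F, |g p| ≤ η / 2 * N := by
    have : 2 * (∑ p ∈ F, |g p|) / η ≤ N := by linarith
    rw [div_le_iff₀ hη] at this
    linarith
  linarith [le_of_abs_le h3]

/-- The tent function of radius `N` on the lattice. -/
noncomputable def tent (N : ℕ) (p : ℤ × ℤ) : ℝ := max 0 (1 - ‖p‖ / N)

lemma tent_zero (N : ℕ) : tent N 0 = 1 := by simp [tent]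

lemma tent_eq_zero {N : ℕ} (hN : 0 < N) {p : ℤ × ℤ} (hp : (N : ℝ) ≤ ‖p‖) : tent N p = 0 := by
  have : (0 : ℝ) < N := by exact_mod_cast hN
  rw [tent, max_eq_left]
  rw [sub_nonpos, one_le_div this]
  exact hp

lemma abs_tent_sub_le {N : ℕ} (hN : 0 < N) (p e : ℤ × ℤ) :
    |tent N p - tent N (p + e)| ≤ ‖e‖ / N := by
  have hN' : (0 : ℝ) < N := by exact_mod_cast hN
  refine (abs_max_sub_max_le_max 0 _ 0 _).trans ?_
  have h : |‖p + e‖ - ‖p‖| ≤ ‖e‖ := by simpa using abs_norm_sub_norm_le (p + e) p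
  have e1 : 1 - ‖p‖ / N - (1 - ‖p + e‖ / N) = (‖p + e‖ - ‖p‖) / N := by ring
  rw [e1, abs_div, abs_of_pos hN']
  simp only [sub_self, abs_zero]
  exact max_le (by positivity) (by gcongr)

/-- Integrality gives ‖p‖ ≥ N + 1 outside the box, which leaves room for a unit shift. -/
lemma norm_lt_of_not_mem_Icc {N : ℕ} {p e : ℤ × ℤ} (he : ‖e‖ ≤ 1)
    (hp : p ∉ Finset.Icc ((-N : ℤ), (-N : ℤ)) ((N : ℤ), (N : ℤ))) : (N : ℝ) ≤ ‖p + e‖ := by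
  have h1 : (N : ℝ) + 1 ≤ ‖p‖ := by
    have h : (N : ℤ) + 1 ≤ max |p.1| |p.2| := by
      simp only [Finset.mem_Icc, Prod.le_def] at hp
      by_contra hlt
      push Not at hlt
      have := max_lt_iff.mp hlt
      have h1 := abs_lt.mp this.1
      have h2 := abs_lt.mp this.2
      apply hp
      exact ⟨⟨by lia, by lia⟩, by lia, by lia⟩
    rw [Prod.norm_def, Int.norm_eq_abs, Int.norm_eq_abs]
    exact_mod_cast h
  have h2 : ‖p‖ ≤ ‖p + e‖ + ‖e‖ := by simpa using norm_sub_le (p + e) e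
  linarith

lemma tsum_tent_mul_shift {N : ℕ} (g : ℤ × ℤ → ℂ) (e : ℤ × ℤ) :
    ∑' p, (tent N p : ℂ) * g (p - e) = ∑' p, (tent N (p + e) : ℂ) * g p := by
  rw [← (Equiv.addRight e).tsum_eq]
  simp

lemma summable_tent_mul {N : ℕ} (hN : 0 < N) (f : ℤ × ℤ → ℂ) {e : ℤ × ℤ} (he : ‖e‖ ≤ 1) :
    Summable fun p => (tent N (p + e) : ℂ) * f p := by
  refine summable_of_ne_finset_zero
    (s := Finset.Icc ((-N : ℤ), (-N : ℤ)) ((N : ℤ), (N : ℤ))) fun p hp => ?_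
  rw [tent_eq_zero hN (norm_lt_of_not_mem_Icc he hp)]
  simp

/-- A square-summable field cannot solve an autoregressive equation with nonzero point source
if the coefficients sum to one. -/
lemma source_eq_zero_of_coeff_sum_eq_one {g : ℤ × ℤ → ℂ} (hs : Summable fun p => ‖g p‖ ^ 2)
    {α β κ w : ℂ} (hsum : α + β + κ = 1)
    (h : ∀ p, g p - α * g (p - (1, 0)) - β * g (p - (0, 1)) - κ * g (p - (1, 1)) =
      if p = 0 then w else 0) : w = 0 := by
  have n1 : ‖((1, 0) : ℤ × ℤ)‖ = 1 := by simp [Prod.norm_def]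
  have n2 : ‖((0, 1) : ℤ × ℤ)‖ = 1 := by simp [Prod.norm_def]
  have n3 : ‖((1, 1) : ℤ × ℤ)‖ = 1 := by simp [Prod.norm_def]
  set C := ‖α‖ + ‖β‖ + ‖κ‖ with hC
  have key : ∀ N : ℕ, 0 < N → ‖w‖ ≤
      ∑ p ∈ Finset.Icc ((-N : ℤ), (-N : ℤ)) ((N : ℤ), (N : ℤ)), C / N * |‖g p‖| := by
    intro N hN
    have s0 := summable_tent_mul hN g (e := 0) (by simp)
    have s1 := (summable_tent_mul hN g n1.le).mul_left α
    have s2 := (summable_tent_mul hN g n2.le).mul_left β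
    have s3 := (summable_tent_mul hN g n3.le).mul_left κ
    have t (e : ℤ × ℤ) (he : ‖e‖ ≤ 1) : Summable fun p => (tent N p : ℂ) * g (p - e) := by
      simpa using summable_tent_mul hN (fun p => g (p - e)) (e := 0) (by simp)
    have e0 : w = ∑' p, (tent N p : ℂ) * (if p = 0 then w else 0) := by
      rw [tsum_eq_single 0 (by intro p hp; simp [hp])]
      simp [tent_zero]
    -- Summation by parts: the shifts move onto the tent, and α + β + κ = 1 leaves only tent
    -- differences, each O(1/N), while the box sum of |g| is o(N).
    have e1 : w = ∑' p, g p * (α * (tent N p - tent N (p + (1, 0)))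
        + β * (tent N p - tent N (p + (0, 1))) + κ * (tent N p - tent N (p + (1, 1)))) := by
      have : w = ∑' p, ((tent N p : ℂ) * g p - α * ((tent N p : ℂ) * g (p - (1, 0)))
          - β * ((tent N p : ℂ) * g (p - (0, 1))) - κ * ((tent N p : ℂ) * g (p - (1, 1)))) := by
        rw [e0]
        congr 1
        ext p
        rw [← h p]
        ring
      simp only [add_zero] at s0
      rw [Summable.tsum_sub ((s0.sub ((t _ n1.le).mul_left α)).sub ((t _ n2.le).mul_left β))
          ((t _ n3.le).mul_left κ),
        Summable.tsum_sub (s0.sub ((t _ n1.le).mul_left α)) ((t _ n2.le).mul_left β),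
        Summable.tsum_sub s0 ((t _ n1.le).mul_left α), tsum_mul_left, tsum_mul_left,
        tsum_mul_left, tsum_tent_mul_shift, tsum_tent_mul_shift, tsum_tent_mul_shift,
        ← tsum_mul_left, ← tsum_mul_left, ← tsum_mul_left, ← Summable.tsum_sub s0 s1,
        ← Summable.tsum_sub (s0.sub s1) s2, ← Summable.tsum_sub ((s0.sub s1).sub s2) s3] at this
      rw [this]
      congr 1
      ext p
      linear_combination ((tent N p : ℂ) * g p) * (-hsum)
    have e2 : w = ∑ p ∈ Finset.Icc ((-N : ℤ), (-N : ℤ)) ((N : ℤ), (N : ℤ)),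
        g p * (α * (tent N p - tent N (p + (1, 0)))
        + β * (tent N p - tent N (p + (0, 1))) + κ * (tent N p - tent N (p + (1, 1)))) := by
      rw [e1]
      refine tsum_eq_sum fun p hp => ?_
      have z0 : tent N p = 0 := tent_eq_zero hN (by
        simpa using norm_lt_of_not_mem_Icc (e := 0) (by simp) hp)
      simp [z0, tent_eq_zero hN (norm_lt_of_not_mem_Icc n1.le hp),
        tent_eq_zero hN (norm_lt_of_not_mem_Icc n2.le hp),
        tent_eq_zero hN (norm_lt_of_not_mem_Icc n3.le hp)]
    have bd (e : ℤ × ℤ) (he : ‖e‖ = 1) (p : ℤ × ℤ) :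
        ‖(tent N p - tent N (p + e) : ℂ)‖ ≤ 1 / N := by
      rw [← Complex.ofReal_sub, Complex.norm_real, Real.norm_eq_abs, ← he]
      exact abs_tent_sub_le hN p e
    calc ‖w‖ = _ := congrArg norm e2
      _ ≤ _ := norm_sum_le _ _
      _ ≤ _ := by
        refine Finset.sum_le_sum fun p _ => ?_
        rw [norm_mul, abs_norm, mul_comm]
        gcongr
        refine (norm_add₃_le).trans ?_
        rw [norm_mul, norm_mul, norm_mul, hC, div_eq_mul_one_div, add_mul, add_mul]
        gcongr
        · exact bd _ n1 p
        · exact bd _ n2 p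
        · exact bd _ n3 p
  have hC0 : 0 ≤ C := by positivity
  rw [← norm_le_zero_iff]
  refine le_of_forall_pos_le_add fun δ hδ => ?_
  obtain ⟨N, hN, hle⟩ := sum_Icc_le_of_summable_sq hs (η := δ / (C + 1)) (by positivity)
  have hN' : (0 : ℝ) < N := by exact_mod_cast hN
  have := key N hN
  rw [← Finset.mul_sum] at this
  calc ‖w‖ ≤ _ := this
    _ ≤ C / N * (δ / (C + 1) * N) := by gcongr
    _ = C / (C + 1) * δ := by field_simp
    _ ≤ 1 * δ := by gcongr; rw [div_le_one (by positivity)]; linarith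
    _ = 0 + δ := by ring

/-! ### Energy estimate and bounded recurrences -/

/-- A square-summable field that is dominated in the sense below vanishes: the multiplier
`1 - b w` is strictly larger than `a + c w` on the unit circle. -/
lemma eq_zero_of_sq_le {a b c : ℝ} (h1 : 0 < (1 - b) ^ 2 - (a + c) ^ 2)
    (h2 : 0 < (1 + b) ^ 2 - (a - c) ^ 2) {u : ℤ × ℤ → ℝ} (hs : Summable fun p => u p ^ 2)
    (d e : ℤ × ℤ)
    (h : ∀ p, (u p - b * u (p + e)) ^ 2 ≤ (a * u (p + d) + c * u (p + d + e)) ^ 2) (p : ℤ × ℤ) :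
    u p = 0 := by
  have sh (d : ℤ × ℤ) : HasSum (fun p => u (p + d) ^ 2) (∑' p, u p ^ 2) :=
    ((Equiv.addRight d).hasSum_iff (f := fun p => u p ^ 2)).mpr hs.hasSum
  have sp : Summable fun p => u p * u (p + e) :=
    Summable.of_norm_bounded (hs.add (sh e).summable) fun p => by
      rw [Real.norm_eq_abs, abs_mul, ← sq_abs (u p), ← sq_abs (u (p + e))]
      linarith [sq_nonneg (|u p| - |u (p + e)|), sq_nonneg (|u p|), sq_nonneg (|u (p + e)|),
        mul_nonneg (abs_nonneg (u p)) (abs_nonneg (u (p + e)))]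
  have spd : HasSum (fun p => u (p + d) * u (p + d + e)) (∑' p, u p * u (p + e)) :=
    ((Equiv.addRight d).hasSum_iff (f := fun p => u p * u (p + e))).mpr sp.hasSum
  have hS0 := hs.hasSum
  have hR0 := sp.hasSum
  have hSe := sh e
  have hSd := sh d
  have hSde := sh (d + e)
  generalize (∑' p, u p ^ 2) = S at *
  generalize (∑' p, u p * u (p + e)) = R at *
  have hl := (hS0.add (hSe.mul_left (b ^ 2))).sub (hR0.mul_left (2 * b))
  have hr := ((hSd.mul_left (a ^ 2)).add (hSde.mul_left (c ^ 2))).add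
    (spd.mul_left (2 * a * c))
  have hle := hasSum_le (fun p => by have := h p; rw [← add_assoc]; linarith) hl hr
  have hp := hasSum_le (fun p => by linarith [sq_nonneg (u p + u (p + e))])
    (hR0.mul_left (-2)) (hS0.add hSe)
  have hm := hasSum_le (fun p => by linarith [sq_nonneg (u p - u (p + e))])
    (hR0.mul_left 2) (hS0.add hSe)
  -- Here |R| ≤ S. The two nonnegative products add up to twice the difference of the sums compared
  -- in `hle`, which is nonpositive, so both vanish.
  have hA : 0 ≤ ((1 - b) ^ 2 - (a + c) ^ 2) * (S + R) := mul_nonneg h1.le (by linarith)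
  have hB : 0 ≤ ((1 + b) ^ 2 - (a - c) ^ 2) * (S - R) := mul_nonneg h2.le (by linarith)
  have hA' : S + R ≤ 0 := nonpos_of_mul_nonpos_right (by linarith) h1
  have hB' : S - R ≤ 0 := nonpos_of_mul_nonpos_right (by linarith) h2
  have hSz : S ≤ 0 := by linarith
  have := le_hasSum hS0 p fun _ _ => sq_nonneg _
  have h0 : u p ^ 2 = 0 := le_antisymm (this.trans hSz) (sq_nonneg _)
  simpa using h0

/-- A bounded solution on `ℕ` of a symmetric hyperbolic second-order recurrence vanishes if it
vanishes at the origin. -/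
lemma eq_zero_of_bounded_recurrence {p q M : ℝ} (hpq : 2 * |q| < p) {d : ℕ → ℝ} (h0 : d 0 = 0)
    (hM : ∀ k, |d k| ≤ M) (hd : ∀ k, p * d (k + 1) = q * (d (k + 2) + d k)) (k : ℕ) : d k = 0 := by
  have hp : 0 < p := lt_of_le_of_lt (by positivity) hpq
  have hM0 : 0 ≤ M := (abs_nonneg _).trans (hM 0)
  -- Each use of the recurrence improves the uniform bound by the factor 2|q|/p < 1; the zero at the
  -- origin starts every round.
  have hb : ∀ n k, |d k| ≤ (2 * |q| / p) ^ n * M := by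
    intro n
    induction n with
    | zero => simpa using hM
    | succ n ih =>
      intro k
      cases k with
      | zero => rw [h0, abs_zero]; positivity
      | succ k =>
        have e : d (k + 1) = q / p * (d (k + 2) + d k) := by
          field_simp
          rw [mul_comm, hd]
        calc |d (k + 1)| = |q| / p * |d (k + 2) + d k| := by
              rw [e, abs_mul, abs_div, abs_of_pos hp]
          _ ≤ |q| / p * ((2 * |q| / p) ^ n * M + (2 * |q| / p) ^ n * M) := by
              gcongr
              exact (abs_add_le _ _).trans (add_le_add (ih _) (ih _))
          _ = _ := by rw [pow_succ]; ring
  have ht : Filter.Tendsto (fun n => (2 * |q| / p) ^ n * M) Filter.atTop (nhds (0 * M)) :=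
    (tendsto_pow_atTop_nhds_zero_of_lt_one (by positivity)
      ((div_lt_one hp).mpr hpq)).mul_const M
  rw [zero_mul] at ht
  exact abs_nonpos_iff.mp (ge_of_tendsto' ht fun n => hb n k)

lemma exists_root_abs_lt_one {p q : ℝ} (hpq : 2 * |q| < p) :
    ∃ r : ℝ, |r| < 1 ∧ p * r = q * (r ^ 2 + 1) := by
  have hp : 0 < p := lt_of_le_of_lt (by positivity) hpq
  have hD : 0 ≤ p ^ 2 - 4 * q ^ 2 := by
    rw [← sq_abs q]
    nlinarith [abs_nonneg q]
  set s := Real.sqrt (p ^ 2 - 4 * q ^ 2) with hs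
  have hs0 : 0 ≤ s := Real.sqrt_nonneg _
  have hs2 : s ^ 2 = p ^ 2 - 4 * q ^ 2 := Real.sq_sqrt hD
  -- The smaller root of qr² - pr + q, rationalised so that q = 0 is allowed.
  refine ⟨2 * q / (p + s), ?_, ?_⟩
  · rw [abs_div, abs_mul, abs_of_pos (by positivity : 0 < p + s), abs_two,
      div_lt_one (by positivity)]
    linarith
  · field_simp
    linear_combination (-q) * hs2

lemma bounded_recurrence_eq_geometric {p q M r : ℝ} (hpq : 2 * |q| < p) (hr : |r| < 1)
    (hroot : p * r = q * (r ^ 2 + 1)) {f : ℕ → ℝ} (hM : ∀ k, |f k| ≤ M)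
    (hf : ∀ k, p * f (k + 1) = q * (f (k + 2) + f k)) (k : ℕ) : f k = f 0 * r ^ k := by
  have := eq_zero_of_bounded_recurrence (d := fun k => f k - f 0 * r ^ k) (M := M + M) hpq
    (by simp) (fun k => ?_) (fun k => ?_) k
  · simpa [sub_eq_zero] using this
  · refine (abs_sub _ _).trans (add_le_add (hM k) ?_)
    rw [abs_mul, abs_pow]
    exact (mul_le_of_le_one_right (abs_nonneg _) (pow_le_one₀ (abs_nonneg _) hr.le)).trans (hM 0)
  · linear_combination hf k - f 0 * r ^ k * hroot

/-! ### Zeros of the symbol on the torus -/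

lemma exists_unit_root {a b c : ℝ}
    (h : ¬ 0 < (1 + b ^ 2 - a ^ 2 - c ^ 2) ^ 2 - 4 * (b + a * c) ^ 2) :
    ∃ z w : ℂ, ‖z‖ = 1 ∧ ‖w‖ = 1 ∧ a * z + b * w + c * (z * w) = 1 := by
  -- For w = x + iy on the unit circle, |1 - bw| = |a + cw| is this linear equation in x; then z is
  -- the quotient (1 - bw)/(a + cw).
  have hx : ∃ x : ℝ, |x| ≤ 1 ∧ 1 + b ^ 2 - a ^ 2 - c ^ 2 = 2 * (b + a * c) * x := by
    by_cases hq : b + a * c = 0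
    · refine ⟨0, by simp, ?_⟩
      rw [hq] at h
      have : (1 + b ^ 2 - a ^ 2 - c ^ 2) ^ 2 = 0 := le_antisymm (by linarith) (sq_nonneg _)
      simpa using this
    · refine ⟨(1 + b ^ 2 - a ^ 2 - c ^ 2) / (2 * (b + a * c)), ?_, by field_simp⟩
      rw [abs_div, div_le_one (by positivity), ← sq_le_sq]
      linarith
  obtain ⟨x, hx1, hx2⟩ := hx
  have hxx := abs_le.mp hx1
  set y := Real.sqrt (1 - x ^ 2) with hy
  have hy2 : y ^ 2 = 1 - x ^ 2 := Real.sq_sqrt (by nlinarith)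
  set w : ℂ := ⟨x, y⟩ with hw
  have hwn : ‖w‖ = 1 := by
    rw [← sq_eq_sq₀ (norm_nonneg _) zero_le_one, Complex.sq_norm, Complex.normSq_apply, hw]
    linear_combination hy2
  have hn : ‖1 - b * w‖ = ‖a + c * w‖ := by
    rw [← sq_eq_sq₀ (norm_nonneg _) (norm_nonneg _), Complex.sq_norm, Complex.sq_norm,
      Complex.normSq_apply, Complex.normSq_apply]
    simp [hw]
    linear_combination (b ^ 2 - c ^ 2) * hy2 + hx2
  by_cases h0 : (a + c * w : ℂ) = 0
  · refine ⟨1, w, by simp, hwn, ?_⟩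
    rw [h0, norm_zero, norm_eq_zero] at hn
    linear_combination h0 - hn
  · refine ⟨(1 - b * w) / (a + c * w), w, ?_, hwn, ?_⟩
    · rw [norm_div, hn, div_self (norm_ne_zero_iff.mpr h0)]
    · linear_combination div_mul_cancel₀ (1 - b * w : ℂ) h0

/-! ### Autoregressive covariances: symmetries, causality, Yule-Walker equations -/

/-- The autoregressive difference operator. -/
def arOp (a b c : ℝ) (f : ℤ → ℤ → ℝ) (h k : ℤ) : ℝ :=
  f h k - a * f (h - 1) k - b * f h (k - 1) - c * f (h - 1) (k - 1)

/-- The formal adjoint of the autoregressive difference operator. -/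
def arOpAdj (a b c : ℝ) (f : ℤ → ℤ → ℝ) (h k : ℤ) : ℝ :=
  f h k - a * f (h + 1) k - b * f h (k + 1) - c * f (h + 1) (k + 1)

/-- The properties of the autocovariance function of a stationary solution of the autoregressive
equation: it is even and maximal at the origin, `arOpAdj a b c γ` (the covariance of the field with
the noise) is square-summable, and applying `arOp` to it yields a point mass. -/
structure IsARCovariance (a b c v : ℝ) (γ : ℤ → ℤ → ℝ) : Prop where
  neg : ∀ h k, γ (-h) (-k) = γ h k
  abs_le : ∀ h k, |γ h k| ≤ γ 0 0
  summable : Summable fun p : ℤ × ℤ => arOpAdj a b c γ p.1 p.2 ^ 2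
  arOp_eq : ∀ h k, arOp a b c (arOpAdj a b c γ) h k = if h = 0 ∧ k = 0 then v else 0

namespace IsARCovariance

variable {a b c v : ℝ} {γ : ℤ → ℤ → ℝ}

lemma pos (hγ : IsARCovariance a b c v γ) (hv : v ≠ 0) : 0 < γ 0 0 := by
  by_contra h0
  have hz (h k : ℤ) : γ h k = 0 := abs_nonpos_iff.mp ((hγ.abs_le h k).trans (not_lt.mp h0))
  have := hγ.arOp_eq 0 0
  simp [arOp, arOpAdj, hz] at this
  exact hv this.symm

lemma swap (hγ : IsARCovariance a b c v γ) : IsARCovariance b a c v fun h k => γ k h := by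
  have e (h k : ℤ) : arOpAdj b a c (fun h k => γ k h) h k = arOpAdj a b c γ k h := by
    simp only [arOpAdj]; ring
  refine ⟨fun h k => hγ.neg k h, fun h k => hγ.abs_le k h, ?_, fun h k => ?_⟩
  · simp only [e]
    exact (Equiv.prodComm ℤ ℤ).summable_iff.mpr hγ.summable
  · simp only [and_comm (a := h = 0), ← hγ.arOp_eq k h, arOp, e]
    ring

/-- The new coefficients are those of -(z/a)·P(1/z, w). -/
lemma reflect_left (hγ : IsARCovariance a b c v γ) (ha : a ≠ 0) :
    IsARCovariance (1 / a) (-c / a) (-b / a) (v / a ^ 2) fun h k => γ (-h) k := by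
  have e (h k : ℤ) : arOpAdj (1 / a) (-c / a) (-b / a) (fun h k => γ (-h) k) h k =
      -(1 / a) * arOpAdj a b c γ (-h - 1) k := by
    simp only [arOpAdj, neg_add', sub_add_cancel]
    field_simp
    ring
  refine ⟨fun h k => hγ.neg (-h) k, fun h k => hγ.abs_le (-h) k, ?_, fun h k => ?_⟩
  · simp only [e, mul_pow]
    refine Summable.mul_left _ ?_
    exact (((Equiv.neg ℤ).trans (Equiv.subRight 1)).prodCongr
      (Equiv.refl ℤ)).summable_iff.mpr hγ.summable
  · have h1 := hγ.arOp_eq (-h) k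
    simp only [neg_eq_zero] at h1
    have h2 : arOp (1 / a) (-c / a) (-b / a)
        (arOpAdj (1 / a) (-c / a) (-b / a) fun h k => γ (-h) k) h k =
        1 / a ^ 2 * arOp a b c (arOpAdj a b c γ) (-h) k := by
      simp only [arOp, e, neg_sub', sub_neg_eq_add, add_sub_cancel_right]
      field_simp
      ring
    rw [h2, h1]
    split_ifs
    · ring
    · simp

/-- The new coefficients are those of -(zw/c)·P(1/z, 1/w); γ itself is unchanged because it is even.
-/
lemma reflect (hγ : IsARCovariance a b c v γ) (hc : c ≠ 0) :
    IsARCovariance (-b / c) (-a / c) (1 / c) (v / c ^ 2) γ := by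
  have e (h k : ℤ) : arOpAdj (-b / c) (-a / c) (1 / c) γ h k =
      -(1 / c) * arOpAdj a b c γ (-h - 1) (-k - 1) := by
    have e0 := hγ.neg (h + 1) (k + 1)
    have e1 := hγ.neg h (k + 1)
    have e2 := hγ.neg (h + 1) k
    have e3 := hγ.neg h k
    simp only [neg_add'] at e0 e1 e2 e3
    simp only [arOpAdj, sub_add_cancel, e0, e1, e2, e3]
    field_simp
    ring
  refine ⟨hγ.neg, hγ.abs_le, ?_, fun h k => ?_⟩
  · simp only [e, mul_pow]
    refine Summable.mul_left _ ?_
    exact (((Equiv.neg ℤ).trans (Equiv.subRight 1)).prodCongr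
      ((Equiv.neg ℤ).trans (Equiv.subRight 1))).summable_iff.mpr hγ.summable
  · have h1 := hγ.arOp_eq (-h) (-k)
    simp only [neg_eq_zero] at h1
    have h2 : arOp (-b / c) (-a / c) (1 / c) (arOpAdj (-b / c) (-a / c) (1 / c) γ) h k =
        1 / c ^ 2 * arOp a b c (arOpAdj a b c γ) (-h) (-k) := by
      simp only [arOp, e, neg_sub', sub_neg_eq_add, add_sub_cancel_right]
      field_simp
      ring
    rw [h2, h1]
    split_ifs
    · ring
    · simp

/-- The autoregressive polynomial of a stationary solution has no zeros on the torus. -/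
lemma discrim_pos (hγ : IsARCovariance a b c v γ) (hv : v ≠ 0) :
    0 < (1 + b ^ 2 - a ^ 2 - c ^ 2) ^ 2 - 4 * (b + a * c) ^ 2 := by
  by_contra hD
  obtain ⟨z, w, hz, hw, hzw⟩ := exists_unit_root hD
  have hz0 : z ≠ 0 := norm_ne_zero_iff.mp (by simp [hz])
  have hw0 : w ≠ 0 := norm_ne_zero_iff.mp (by simp [hw])
  set g := arOpAdj a b c γ
  -- Twisting g by the unimodular character zᵐwⁿ preserves ℓ² norms and the point source, and turns
  -- the coefficients into az, bw, czw, which sum to 1.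
  have key := source_eq_zero_of_coeff_sum_eq_one
    (g := fun p : ℤ × ℤ => (g p.1 p.2 : ℂ) * (z ^ p.1 * w ^ p.2)) (w := v) (by
      simpa [hz, hw] using hγ.summable) hzw (fun p => by
      have h := hγ.arOp_eq p.1 p.2
      have hz1 : z ^ p.1 = z ^ (p.1 - 1) * z := by rw [zpow_sub_one₀ hz0]; field_simp
      have hw1 : w ^ p.2 = w ^ (p.2 - 1) * w := by rw [zpow_sub_one₀ hw0]; field_simp
      have h' : (g p.1 p.2 - a * g (p.1 - 1) p.2 - b * g p.1 (p.2 - 1)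
          - c * g (p.1 - 1) (p.2 - 1) : ℂ) = if p = 0 then (v : ℂ) else 0 := by
        have := congrArg (fun x : ℝ => (x : ℂ)) h
        simp only [arOp] at this
        push_cast at this
        rw [this]
        simp [Prod.ext_iff, apply_ite Complex.ofReal]
      have h'' : (if p = 0 then (v : ℂ) else 0) = (if p = 0 then (v : ℂ) else 0)
          * (z ^ p.1 * w ^ p.2) := by
        by_cases hp : p = 0 <;> simp [hp]
      rw [h'', ← h']
      simp only [Prod.fst_sub, Prod.snd_sub, sub_zero]
      rw [hz1, hw1]
      ring)
  exact hv (by exact_mod_cast key)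

lemma arOpAdj_eq_zero (hγ : IsARCovariance a b c v γ) (h₁ : 0 < 1 - a - b - c)
    (h₂ : 0 < 1 + a - b + c) (h₃ : 0 < 1 - a + b + c) (h₄ : 0 < 1 + a + b - c)
    {h : ℤ} (hh : h < 0) (k : ℤ) : arOpAdj a b c γ h k = 0 := by
  -- Truncating to h < 0 keeps the inequality everywhere: it is an equality for h < 0, and for h ≥ 0
  -- the left side is zero because e = (0,-1) does not change h.
  have key := eq_zero_of_sq_le (a := a) (b := b) (c := c)
    (by nlinarith [mul_pos h₁ h₂]) (by nlinarith [mul_pos h₃ h₄])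
    (u := fun p : ℤ × ℤ => if p.1 < 0 then arOpAdj a b c γ p.1 p.2 else 0)
    (Summable.of_nonneg_of_le (fun _ => sq_nonneg _) (fun p => by
      split_ifs
      · exact le_rfl
      · simp [sq_nonneg]) hγ.summable) (-1, 0) (0, -1) (fun p => by
      obtain ⟨m, n⟩ := p
      by_cases hm : m < 0
      · have hm1 : m + -1 < 0 := by lia
        have := hγ.arOp_eq m n
        rw [if_neg (by lia)] at this
        simp only [arOp, sub_eq_add_neg] at this
        simp only [Prod.mk_add_mk, add_zero, hm, hm1, if_true]
        refine le_of_eq ?_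
        congr 1
        linear_combination this
      · simp only [Prod.mk_add_mk, add_zero, hm, if_false]
        simpa using sq_nonneg _) (h, k)
  simpa [hh] using key

lemma yuleWalker (hγ : IsARCovariance a b c v γ) (h₁ : 0 < 1 - a - b - c)
    (h₂ : 0 < 1 + a - b + c) (h₃ : 0 < 1 - a + b + c) (h₄ : 0 < 1 + a + b - c)
    {h : ℤ} (hh : 0 < h) (k : ℤ) :
    γ h k = a * γ (h - 1) k + b * γ h (k - 1) + c * γ (h - 1) (k - 1) := by
  have e := hγ.arOpAdj_eq_zero h₁ h₂ h₃ h₄ (neg_lt_zero.mpr hh) (-k)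
  have e1 := hγ.neg (h - 1) k
  have e2 := hγ.neg h (k - 1)
  have e3 := hγ.neg (h - 1) (k - 1)
  simp only [neg_sub', sub_neg_eq_add] at e1 e2 e3
  rw [arOpAdj, hγ.neg, e1, e2, e3] at e
  linarith

lemma yuleWalker_right (hγ : IsARCovariance a b c v γ) (h₁ : 0 < 1 - a - b - c)
    (h₂ : 0 < 1 + a - b + c) (h₃ : 0 < 1 - a + b + c) (h₄ : 0 < 1 + a + b - c)
    {k : ℤ} (hk : k < 0) (h : ℤ) :
    γ h k = a * γ (h + 1) k + b * γ h (k + 1) + c * γ (h + 1) (k + 1) := by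
  have e := hγ.swap.arOpAdj_eq_zero (by linarith) (by linarith) (by linarith) (by linarith) hk h
  rw [arOpAdj] at e
  linarith

lemma exists_geometric (hγ : IsARCovariance a b c v γ) (h₁ : 0 < 1 - a - b - c)
    (h₂ : 0 < 1 + a - b + c) (h₃ : 0 < 1 - a + b + c) (h₄ : 0 < 1 + a + b - c) :
    ∃ r : ℝ, |r| < 1 ∧
    ∀ h : ℤ, 0 ≤ h → ∀ k : ℕ, γ h (-k) = γ h 0 * r ^ k := by
  have hpq : 2 * |b + a * c| < 1 + b ^ 2 - a ^ 2 - c ^ 2 := by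
    have := mul_pos h₁ h₂
    have := mul_pos h₃ h₄
    rcases abs_cases (b + a * c) with h | h <;> nlinarith
  obtain ⟨r, hr, hroot⟩ := exists_root_abs_lt_one hpq
  refine ⟨r, hr, fun h hh k => ?_⟩
  have := bounded_recurrence_eq_geometric hpq hr hroot (f := fun k : ℕ => γ h (-k))
    (fun k => hγ.abs_le _ _) (fun k => ?_) k
  · simpa using this
  · have e1 := hγ.yuleWalker_right h₁ h₂ h₃ h₄ (k := -(k + 1)) (by lia) h
    have e2 := hγ.yuleWalker_right h₁ h₂ h₃ h₄ (k := -(k + 2)) (by lia) h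
    have e3 := hγ.yuleWalker h₁ h₂ h₃ h₄ (h := h + 1) (by lia) (-(k + 1))
    have e4 := hγ.yuleWalker h₁ h₂ h₃ h₄ (h := h + 1) (by lia) (-k)
    have k1 : -((k : ℤ) + 1) + 1 = -k := by ring
    have k2 : -((k : ℤ) + 2) + 1 = -(k + 1) := by ring
    have k3 : -((k : ℤ) + 1) - 1 = -(k + 2) := by ring
    have k4 : -(k : ℤ) - 1 = -(k + 1) := by ring
    rw [k1] at e1
    rw [k2] at e2
    rw [k3, add_sub_cancel_right] at e3
    rw [k4, add_sub_cancel_right] at e4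
    push_cast
    -- The column h + 1 is eliminated, leaving a recurrence in column h alone, with coefficients
    -- independent of h; hence one ratio r serves all h ≥ 0.
    linear_combination e1 - b * e2 + a * e3 + c * e4

end IsARCovariance

/-! ### Separability in the causal case -/

/-- Separability of an autocovariance function in two opposite quadrants, and failure of
separability in the others unless `a * b + c = 0`. -/
structure IsQuadrantSeparable (a b c : ℝ) (γ : ℤ → ℤ → ℝ) : Prop where
  quadrant : ∀ h k, h * k ≤ 0 → γ h k = γ h 0 * γ 0 k / γ 0 0
  ne : a * b + c ≠ 0 → γ 1 0 * γ 0 1 / γ 0 0 ≠ γ 1 1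
  all : a * b + c = 0 → ∀ h k, γ h k = γ h 0 * γ 0 k / γ 0 0

namespace IsARCovariance

variable {a b c v : ℝ} {γ : ℤ → ℤ → ℝ}

lemma isQuadrantSeparable_of_causal (hγ : IsARCovariance a b c v γ) (hv : v ≠ 0)
    (h₁ : 0 < 1 - a - b - c) (h₂ : 0 < 1 + a - b + c) (h₃ : 0 < 1 - a + b + c)
    (h₄ : 0 < 1 + a + b - c) : IsQuadrantSeparable a b c γ := by
  have hpos := hγ.pos hv
  have hne := hpos.ne'
  obtain ⟨r, hr, hgr⟩ := hγ.exists_geometric h₁ h₂ h₃ h₄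
  obtain ⟨s, hs, hgs⟩ := hγ.swap.exists_geometric (by linarith) (by linarith) (by linarith)
    (by linarith)
  have g0 (n : ℕ) : γ 0 n = γ 0 0 * r ^ n := by
    rw [← hgr 0 le_rfl, ← hγ.neg, neg_zero]
  have gm (n : ℕ) : γ n 0 = γ 0 0 * s ^ n := by
    rw [← hgs 0 le_rfl, ← hγ.neg, neg_zero]
  have gq (m n : ℕ) : γ m (-n) = γ 0 0 * s ^ m * r ^ n := by
    rw [hgr m (by lia), gm]
  have quad (m n : ℕ) : γ m (-n) = γ m 0 * γ 0 n / γ 0 0 := by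
    rw [gq, g0, gm]
    field_simp
  have g0' (n : ℕ) : γ 0 (-n) = γ 0 n := by simpa using hγ.neg 0 n
  have gm' (n : ℕ) : γ (-n) 0 = γ n 0 := by simpa using hγ.neg n 0
  have y1 := hγ.yuleWalker h₁ h₂ h₃ h₄ zero_lt_one 0
  have y2 := hγ.yuleWalker_right h₁ h₂ h₃ h₄ (k := -1) (by norm_num) 0
  have y3 := hγ.yuleWalker h₁ h₂ h₃ h₄ zero_lt_one 1
  have q00 := gq 1 1
  have q0 := gq 0 1
  have q1 := gm 1
  have q2 := g0 1
  norm_num at y1 y2 y3 q00 q0 q1 q2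
  rw [q00, q0, q1] at y1 y2
  have hse : s = a + b * (s * r) + c * r := mul_left_cancel₀ hne (by linarith)
  have hre : r = a * (s * r) + b + c * s := mul_left_cancel₀ hne (by linarith)
  have hr2 : r ^ 2 < 1 := (sq_lt_one_iff_abs_lt_one r).mpr hr
  have hs2 : s ^ 2 < 1 := (sq_lt_one_iff_abs_lt_one s).mpr hs
  refine ⟨fun h k hhk => ?_, fun hab heq => ?_, fun hab => ?_⟩
  · rcases le_total 0 h with hh | hh <;> rcases le_total 0 k with hk | hk
    · obtain rfl | rfl : h = 0 ∨ k = 0 := mul_eq_zero.mp (le_antisymm hhk (mul_nonneg hh hk))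
      · field_simp
      · field_simp
    · lift h to ℕ using hh
      obtain ⟨n, rfl⟩ := Int.exists_eq_neg_ofNat hk
      rw [quad, g0']
    · obtain ⟨m, rfl⟩ := Int.exists_eq_neg_ofNat hh
      lift k to ℕ using hk
      rw [← hγ.neg, neg_neg, quad, gm']
    · obtain rfl | rfl : h = 0 ∨ k = 0 :=
        mul_eq_zero.mp (le_antisymm hhk (mul_nonneg_of_nonpos_of_nonpos hh hk))
      · field_simp
      · field_simp
  · rw [div_eq_iff hne, y3, q1, q2] at heq
    have hprod : s * r = a * r + b * s + c :=
      mul_left_cancel₀ (pow_ne_zero 2 hne) (by linear_combination heq)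
    -- Separability at (1,1) would force s = a and r = b, and then `hprod` reads ab + c = 0.
    have ha : (1 - r ^ 2) * (s - a) = 0 := by linear_combination hse - r * hprod
    have hb : (1 - s ^ 2) * (r - b) = 0 := by linear_combination hre - s * hprod
    have ha' : s = a := sub_eq_zero.mp ((mul_eq_zero.mp ha).resolve_left (by linarith))
    have hb' : r = b := sub_eq_zero.mp ((mul_eq_zero.mp hb).resolve_left (by linarith))
    rw [ha', hb'] at hprod
    exact hab (by linarith)
  · have hc : c = -(a * b) := by linarith
    have hb1 : |b| < 1 := abs_lt.mpr ⟨by linarith, by linarith⟩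
    have ha1 : |a| < 1 := abs_lt.mpr ⟨by linarith, by linarith⟩
    have hbr : b * r ≠ 1 := fun h => by
      have := mul_lt_mul'' hb1 hr (abs_nonneg _) (abs_nonneg _)
      rw [← abs_mul, h, abs_one] at this
      linarith
    have has : a * s ≠ 1 := fun h => by
      have := mul_lt_mul'' ha1 hs (abs_nonneg _) (abs_nonneg _)
      rw [← abs_mul, h, abs_one] at this
      linarith
    have ha' : s = a := by
      have : (1 - b * r) * (s - a) = 0 := by linear_combination hse + r * hc
      exact sub_eq_zero.mp ((mul_eq_zero.mp this).resolve_left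
        (sub_ne_zero.mpr (Ne.symm hbr)))
    have hb' : r = b := by
      have : (1 - a * s) * (r - b) = 0 := by linear_combination hre + s * hc
      exact sub_eq_zero.mp ((mul_eq_zero.mp this).resolve_left
        (sub_ne_zero.mpr (Ne.symm has)))
    have gp (m n : ℕ) : γ m n = γ 0 0 * a ^ m * b ^ n := by
      induction m generalizing n with
      | zero => simpa [hb'] using g0 n
      | succ m ih =>
        induction n with
        | zero => simpa [ha'] using gm (m + 1)
        | succ n ihn =>
          have y := hγ.yuleWalker h₁ h₂ h₃ h₄ (h := (m + 1 : ℕ)) (by lia) (n + 1 : ℕ)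
          have k1 : ((m + 1 : ℕ) : ℤ) - 1 = m := by push_cast; ring
          have k2 : ((n + 1 : ℕ) : ℤ) - 1 = n := by push_cast; ring
          rw [k1, k2, ih, ih, ihn] at y
          rw [y, hc]
          ring
    have pos_quad (m n : ℕ) : γ m n = γ m 0 * γ 0 n / γ 0 0 := by
      rw [gp, gm, g0, ha', hb']
      field_simp
    intro h k
    rcases le_total 0 h with hh | hh <;> rcases le_total 0 k with hk | hk
    · lift h to ℕ using hh
      lift k to ℕ using hk
      exact pos_quad h k
    · lift h to ℕ using hh
      obtain ⟨n, rfl⟩ := Int.exists_eq_neg_ofNat hk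
      rw [quad, g0']
    · obtain ⟨m, rfl⟩ := Int.exists_eq_neg_ofNat hh
      lift k to ℕ using hk
      rw [← hγ.neg, neg_neg, quad, gm']
    · obtain ⟨m, rfl⟩ := Int.exists_eq_neg_ofNat hh
      obtain ⟨n, rfl⟩ := Int.exists_eq_neg_ofNat hk
      rw [hγ.neg, g0', gm', pos_quad]

end IsARCovariance

/-! ### Reduction to the causal case by reflections -/

/-- The products force a common sign, and the four factors sum to 4. -/
lemma pos_of_mul_pos_of_mul_pos {a b c : ℝ} (h₁₂ : 0 < (1 - a - b - c) * (1 + a - b + c))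
    (h₁₄ : 0 < (1 - a - b - c) * (1 + a + b - c)) (h₂₃ : 0 < (1 + a - b + c) * (1 - a + b + c)) :
    0 < 1 - a - b - c ∧ 0 < 1 + a - b + c ∧ 0 < 1 - a + b + c ∧ 0 < 1 + a + b - c := by
  rcases pos_and_pos_or_neg_and_neg_of_mul_pos h₁₂ with ⟨h1, h2⟩ | ⟨h1, h2⟩
  · exact ⟨h1, h2, (pos_iff_pos_of_mul_pos h₂₃).mp h2, (pos_iff_pos_of_mul_pos h₁₄).mp h1⟩
  · have h3 := neg_of_mul_pos_right h₂₃ h2.le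
    have h4 := neg_of_mul_pos_right h₁₄ h1.le
    linarith

lemma two_mul_abs_lt {p q : ℝ} (hp : 0 < p) (h : 0 < p ^ 2 - 4 * q ^ 2) : 2 * |q| < p := by
  refine lt_of_pow_lt_pow_left₀ 2 hp.le ?_
  rw [mul_pow, sq_abs]
  linarith

namespace IsARCovariance

variable {a b c v : ℝ} {γ : ℤ → ℤ → ℝ}

lemma isQuadrantSeparable_of_pos (hγ : IsARCovariance a b c v γ) (hv : v ≠ 0)
    (hb : 0 < 1 + b ^ 2 - a ^ 2 - c ^ 2) (hc : 0 < 1 + c ^ 2 - a ^ 2 - b ^ 2) :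
    IsQuadrantSeparable a b c γ := by
  have hD := hγ.discrim_pos hv
  have h1 := abs_lt.mp (by linarith [two_mul_abs_lt hb hD] :
    |b + a * c| < (1 + b ^ 2 - a ^ 2 - c ^ 2) / 2)
  have h2 := abs_lt.mp (by linarith [two_mul_abs_lt hc (q := c + a * b) (by linarith)] :
    |c + a * b| < (1 + c ^ 2 - a ^ 2 - b ^ 2) / 2)
  obtain ⟨f1, f2, f3, f4⟩ := pos_of_mul_pos_of_mul_pos (a := a) (b := b) (c := c)
    (by linarith) (by linarith) (by linarith)
  exact hγ.isQuadrantSeparable_of_causal hv f1 f2 f3 f4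

lemma isQuadrantSeparable (hγ : IsARCovariance a b c v γ) (hv : v ≠ 0)
    (hc : 0 < 1 + c ^ 2 - a ^ 2 - b ^ 2) : IsQuadrantSeparable a b c γ := by
  have hD := hγ.discrim_pos hv
  rcases lt_trichotomy 0 (1 + b ^ 2 - a ^ 2 - c ^ 2) with hb | hb | hb
  · exact hγ.isQuadrantSeparable_of_pos hv hb hc
  · rw [← hb] at hD
    nlinarith [sq_nonneg (b + a * c)]
  -- `reflect` flips the sign of 1+b²-a²-c² and keeps that of 1+c²-a²-b², up to positive factors.
  · have hc0 : c ≠ 0 := by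
      rintro rfl
      have h1 := two_mul_abs_lt (neg_pos.mpr hb) (q := b + a * 0) (by linarith)
      have h2 := two_mul_abs_lt hc (q := 0 + a * b) (by linarith)
      nlinarith [sq_nonneg b]
    have hc2 : 0 < c ^ 2 := by positivity
    have e1 : 1 + (-a / c) ^ 2 - (-b / c) ^ 2 - (1 / c) ^ 2 =
        (c ^ 2 + a ^ 2 - b ^ 2 - 1) / c ^ 2 := by field_simp
    have e2 : 1 + (1 / c) ^ 2 - (-b / c) ^ 2 - (-a / c) ^ 2 =
        (1 + c ^ 2 - a ^ 2 - b ^ 2) / c ^ 2 := by field_simp; ring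
    have e3 : -b / c * (-a / c) + 1 / c = (a * b + c) / c ^ 2 := by field_simp
    have h := (hγ.reflect hc0).isQuadrantSeparable_of_pos (by positivity)
      (e1 ▸ div_pos (by linarith) hc2) (e2 ▸ div_pos hc hc2)
    exact ⟨h.quadrant, fun hab => h.ne (e3 ▸ div_ne_zero hab hc2.ne'),
      fun hab => h.all (by rw [e3, hab, zero_div])⟩

lemma isQuadrantSeparable_reflect_left (hγ : IsARCovariance a b c v γ) (hv : v ≠ 0)
    (ha : a ≠ 0) (hc : 1 + c ^ 2 - a ^ 2 - b ^ 2 < 0) :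
    IsQuadrantSeparable a b c fun h k => γ (-h) k := by
  have ha2 : 0 < a ^ 2 := by positivity
  have e1 : 1 + (-b / a) ^ 2 - (1 / a) ^ 2 - (-c / a) ^ 2 =
      -(1 + c ^ 2 - a ^ 2 - b ^ 2) / a ^ 2 := by field_simp; ring
  have e2 : 1 / a * (-c / a) + -b / a = -(a * b + c) / a ^ 2 := by field_simp; ring
  have h := (hγ.reflect_left ha).isQuadrantSeparable (by positivity)
    (e1 ▸ div_pos (neg_pos.mpr hc) ha2)
  exact ⟨h.quadrant, fun hab => h.ne (e2 ▸ div_ne_zero (neg_ne_zero.mpr hab) ha2.ne'),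
    fun hab => h.all (by rw [e2, hab, neg_zero, zero_div])⟩

lemma isQuadrantSeparable_reflect (hγ : IsARCovariance a b c v γ) (hv : v ≠ 0)
    (hc : 1 + c ^ 2 - a ^ 2 - b ^ 2 < 0) :
    IsQuadrantSeparable a b c fun h k => γ (-h) k := by
  by_cases ha : a = 0
  · have hb : b ≠ 0 := by
      rintro rfl
      rw [ha] at hc
      nlinarith [sq_nonneg c]
    -- With a = 0 the other axis is reflected instead; evenness makes the two reflections of γ
    -- agree.
    have h := hγ.swap.isQuadrantSeparable_reflect_left hv hb (by linarith)
    have e (h k : ℤ) : γ (-h) k = γ h (-k) := by simpa using hγ.neg h (-k)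
    simp only [e]
    refine ⟨fun m n hmn => ?_, fun hab => ?_, fun hab m n => ?_⟩
    · rw [mul_comm (γ m (-0))]
      exact h.quadrant n m (by linarith)
    · rw [mul_comm (γ 1 (-0))]
      exact h.ne (by rwa [mul_comm])
    · rw [mul_comm (γ m (-0))]
      exact h.all (by rwa [mul_comm]) n m
  · exact hγ.isQuadrantSeparable_reflect_left hv ha hc

end IsARCovariance

/-! ### From the random field to its covariance function -/

section Covariance

variable {Ω : Type*} [MeasurableSpace Ω] {μ : Measure Ω} {a b c v : ℝ} {X ε : ℤ → ℤ → Ω → ℝ}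

lemma covariance_congr_left {Y Y' Z : Ω → ℝ} (h : Y =ᵐ[μ] Y') : cov[Y, Z; μ] = cov[Y', Z; μ] := by
  simp only [covariance, integral_congr_ae h]
  refine integral_congr_ae ?_
  filter_upwards [h] with ω hω
  rw [hω]

lemma IsWideSenseStationary.cov_eq (hX : IsWideSenseStationary μ X) (i j k l : ℤ) :
    cov[X i j, X k l; μ] = acov μ X (i - k) (j - l) := by
  simpa using hX.cov_eq_acov i j (i - k) (j - l)

lemma IsWideSenseStationary.acov_neg (hX : IsWideSenseStationary μ X) (h k : ℤ) :
    acov μ X (-h) (-k) = acov μ X h k := by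
  have := hX.cov_eq h k 0 0
  rw [covariance_comm, hX.cov_eq] at this
  simpa using this

lemma IsWideSenseStationary.variance_eq (hX : IsWideSenseStationary μ X) (i j : ℤ) :
    Var[X i j; μ] = acov μ X 0 0 := by
  rw [← covariance_self (hX.memLp_two i j).aestronglyMeasurable.aemeasurable, hX.cov_eq, sub_self,
    sub_self]

lemma IsWhiteNoise.cov_eq (hε : IsWhiteNoise μ ε v) (i j k l : ℤ) :
    cov[ε i j, ε k l; μ] = if (i, j) = (k, l) then v else 0 := by
  split_ifs with h
  · obtain ⟨rfl, rfl⟩ := Prod.mk.inj h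
    rw [covariance_self (hε.memLp_two i j).aestronglyMeasurable.aemeasurable, hε.variance_eq]
  · exact hε.uncorrelated i j k l h

variable [IsProbabilityMeasure μ]

lemma IsWideSenseStationary.abs_acov_le (hX : IsWideSenseStationary μ X) (h k : ℤ) :
    |acov μ X h k| ≤ acov μ X 0 0 := by
  have e : cov[X h k, X 0 0; μ] = acov μ X h k := by simpa using hX.cov_eq h k 0 0
  have h1 := variance_nonneg (X h k + X 0 0) μ
  have h2 := variance_nonneg (X h k - X 0 0) μ
  rw [variance_add (hX.memLp_two _ _) (hX.memLp_two _ _), hX.variance_eq, hX.variance_eq, e] at h1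
  rw [variance_sub (hX.memLp_two _ _) (hX.memLp_two _ _), hX.variance_eq, hX.variance_eq, e] at h2
  exact abs_le.mpr ⟨by linarith, by linarith⟩

lemma SatisfiesAR.cov_noise (hAR : SatisfiesAR μ a b c X ε) (hX : ∀ i j, MemLp (X i j) 2 μ)
    {Y : Ω → ℝ} (hY : MemLp Y 2 μ) (i j : ℤ) :
    cov[ε i j, Y; μ] = cov[X i j, Y; μ] - a * cov[X (i - 1) j, Y; μ]
      - b * cov[X i (j - 1), Y; μ] - c * cov[X (i - 1) (j - 1), Y; μ] := by
  have e : ε i j =ᵐ[μ] X i j - a • X (i - 1) j - b • X i (j - 1) - c • X (i - 1) (j - 1) := by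
    filter_upwards [hAR i j] with ω hω
    simp only [Pi.sub_apply, Pi.smul_apply, smul_eq_mul]
    linarith
  have m1 := (hX (i - 1) j).const_smul a
  have m2 := (hX i (j - 1)).const_smul b
  have m3 := (hX (i - 1) (j - 1)).const_smul c
  rw [covariance_congr_left e, covariance_sub_left (((hX i j).sub m1).sub m2) m3 hY,
    covariance_sub_left ((hX i j).sub m1) m2 hY, covariance_sub_left (hX i j) m1 hY,
    covariance_smul_left, covariance_smul_left, covariance_smul_left]

lemma SatisfiesAR.cov_field_noise (hAR : SatisfiesAR μ a b c X ε)
    (hX : IsWideSenseStationary μ X) (i j k l : ℤ) :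
    cov[X i j, ε k l; μ] = arOpAdj a b c (acov μ X) (i - k) (j - l) := by
  rw [covariance_comm, hAR.cov_noise hX.memLp_two (hX.memLp_two i j)]
  simp only [covariance_comm _ (X i j), hX.cov_eq, arOpAdj, ← sub_add]

/-- Bessel's inequality for covariances with a white noise. -/
lemma IsWhiteNoise.sum_sq_cov_le (hε : IsWhiteNoise μ ε v) (hv : 0 < v) {Y : Ω → ℝ}
    (hY : MemLp Y 2 μ) (F : Finset (ℤ × ℤ)) :
    ∑ p ∈ F, cov[Y, ε p.1 p.2; μ] ^ 2 ≤ v * Var[Y; μ] := by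
  set t : ℤ × ℤ → ℝ := fun p => cov[Y, ε p.1 p.2; μ] / v with ht
  have hm : ∀ p ∈ F, MemLp (t p • ε p.1 p.2) 2 μ := fun p _ =>
    (hε.memLp_two p.1 p.2).const_smul (t p)
  -- The residual of the projection of Y onto the noise variables indexed by F.
  have h := variance_nonneg (Y - ∑ p ∈ F, t p • ε p.1 p.2) μ
  rw [variance_sub hY (memLp_finsetSum' F hm), covariance_sum_right' hm hY, variance_sum' hm] at h
  have e1 : ∑ p ∈ F, cov[Y, t p • ε p.1 p.2; μ] = (∑ p ∈ F, cov[Y, ε p.1 p.2; μ] ^ 2) / v := by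
    rw [Finset.sum_div]
    refine Finset.sum_congr rfl fun p _ => ?_
    rw [covariance_smul_right, ht]
    ring
  have e2 : ∑ p ∈ F, ∑ q ∈ F, cov[t p • ε p.1 p.2, t q • ε q.1 q.2; μ] =
      (∑ p ∈ F, cov[Y, ε p.1 p.2; μ] ^ 2) / v := by
    rw [Finset.sum_div]
    refine Finset.sum_congr rfl fun p hp => ?_
    simp only [covariance_smul_left, covariance_smul_right, hε.cov_eq, Prod.mk.eta, mul_ite,
      mul_zero, Finset.sum_ite_eq, hp, if_true, ht]
    field_simp
  rw [e1, e2] at h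
  have h' : (∑ p ∈ F, cov[Y, ε p.1 p.2; μ] ^ 2) / v ≤ Var[Y; μ] := by linarith
  rwa [div_le_iff₀' hv] at h'

lemma SatisfiesAR.isARCovariance (hAR : SatisfiesAR μ a b c X ε)
    (hX : IsWideSenseStationary μ X) (hε : IsWhiteNoise μ ε v) (hv : 0 < v) :
    IsARCovariance a b c v (acov μ X) where
  neg := hX.acov_neg
  abs_le := hX.abs_acov_le
  summable := by
    -- Since cov(X_{0,0}, ε_p) = g(-p), Bessel's inequality for X_{0,0} applies after this
    -- reindexing.
    rw [← (Equiv.neg (ℤ × ℤ)).summable_iff]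
    refine summable_of_sum_le (fun _ => sq_nonneg _) (c := v * Var[X 0 0; μ]) fun F => ?_
    refine le_of_eq_of_le (Finset.sum_congr rfl fun p _ => ?_)
      (hε.sum_sq_cov_le hv (hX.memLp_two 0 0) F)
    simp [hAR.cov_field_noise hX]
  arOp_eq h k := by
    have e := hAR.cov_noise hX.memLp_two (hε.memLp_two 0 0) h k
    simp only [hAR.cov_field_noise hX, hε.cov_eq, sub_zero, Prod.mk.injEq] at e
    exact e.symm

end Covariance

end PlanarAR

theorem mainTheorem11 {Ω : Type*} [MeasurableSpace Ω] (μ : Measure Ω) [IsProbabilityMeasure μ]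
    (a b c v : ℝ) (hv : 0 < v) (X ε : ℤ → ℤ → Ω → ℝ)
    (hX : PlanarAR.IsWideSenseStationary μ X)
    (hε : PlanarAR.IsWhiteNoise μ ε v)
    (hAR : PlanarAR.SatisfiesAR μ a b c X ε) :
    0 < PlanarAR.acov μ X 0 0 ∧
    (a * b + c = 0 →
      ∀ h₁ h₂ : ℤ, PlanarAR.acov μ X h₁ h₂ =
        PlanarAR.acov μ X h₁ 0 * PlanarAR.acov μ X 0 h₂ / PlanarAR.acov μ X 0 0) ∧
    (a * b + c ≠ 0 → 1 + c ^ 2 > a ^ 2 + b ^ 2 →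
      PlanarAR.acov μ X 1 (-1) =
        PlanarAR.acov μ X 1 0 * PlanarAR.acov μ X 0 1 / PlanarAR.acov μ X 0 0 ∧
      PlanarAR.acov μ X 1 0 * PlanarAR.acov μ X 0 1 / PlanarAR.acov μ X 0 0 ≠
        PlanarAR.acov μ X 1 1 ∧
      ∀ h₁ h₂ : ℤ, h₁ * h₂ ≤ 0 → PlanarAR.acov μ X h₁ h₂ =
        PlanarAR.acov μ X h₁ 0 * PlanarAR.acov μ X 0 h₂ / PlanarAR.acov μ X 0 0) ∧
    (a * b + c ≠ 0 → 1 + c ^ 2 < a ^ 2 + b ^ 2 →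
      PlanarAR.acov μ X 1 (-1) ≠
        PlanarAR.acov μ X 1 0 * PlanarAR.acov μ X 0 1 / PlanarAR.acov μ X 0 0 ∧
      PlanarAR.acov μ X 1 0 * PlanarAR.acov μ X 0 1 / PlanarAR.acov μ X 0 0 =
        PlanarAR.acov μ X 1 1 ∧
      ∀ h₁ h₂ : ℤ, 0 ≤ h₁ * h₂ → PlanarAR.acov μ X h₁ h₂ =
        PlanarAR.acov μ X h₁ 0 * PlanarAR.acov μ X 0 h₂ / PlanarAR.acov μ X 0 0) := by
  have hγ := hAR.isARCovariance hX hε hv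
  have hpos := hγ.pos hv.ne'
  have hD := hγ.discrim_pos hv.ne'
  set γ := PlanarAR.acov μ X
  have e (h k : ℤ) : γ (-h) k = γ h (-k) := by simpa using hγ.neg h (-k)
  have e0 (h : ℤ) : γ (-h) 0 = γ h 0 := by simpa using e h 0
  refine ⟨hpos, fun hab h₁ h₂ => ?_, fun hab hc => ?_, fun hab hc => ?_⟩
  · rcases lt_trichotomy 0 (1 + c ^ 2 - a ^ 2 - b ^ 2) with hc | hc | hc
    · exact (hγ.isQuadrantSeparable hv.ne' hc).all hab h₁ h₂
    -- Here D = -4(c+ab)² ≤ 0, against `hD`.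
    · nlinarith [sq_nonneg (a * b + c)]
    · simpa [e0] using (hγ.isQuadrantSeparable_reflect hv.ne' hc).all hab (-h₁) h₂
  · have hs := hγ.isQuadrantSeparable hv.ne' (by linarith)
    have h1 := hs.quadrant 1 (-1) (by norm_num)
    have h2 : γ 0 (-1) = γ 0 1 := by simpa using hγ.neg 0 1
    rw [h2] at h1
    exact ⟨h1, hs.ne hab, hs.quadrant⟩
  · have hs := hγ.isQuadrantSeparable_reflect hv.ne' (by linarith)
    have q (h₁ h₂ : ℤ) (hh : 0 ≤ h₁ * h₂) : γ h₁ h₂ = γ h₁ 0 * γ 0 h₂ / γ 0 0 := by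
      simpa [e0] using hs.quadrant (-h₁) h₂ (by linarith)
    refine ⟨fun h => ?_, (q 1 1 (by norm_num)).symm, q⟩
    have hne := hs.ne hab
    simp only [e0, neg_zero] at hne
    exact hne (by rw [e, h])
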